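/- Let $F$ be a free group of finite rank with basis $\{x_1,\dots,x_m\}$, let $e_1,\dots,e_m\ge 0$ be integers with $e_m\mid e_{m-1}\mid\dots\mid e_1$, and let $S=\langle x_1^{e_1},\dots,x_m^{e_m},\gamma_2(F)\rangle$, where $\gamma_n(G)$ denotes the $n$-th term of the lower central series of a group $G$ (with $\gamma_1(G)=G$). Let $\mathfrak f$ be the augmentation ideal of the integral group ring $\mathbb Z[F]$, let $\mathfrak s$ be the two-sided ideal of $\mathbb Z[F]$ generated by the elements $s-1$ with $s\in S$, and for a two-sided ideal $\mathfrak a$ of $\mathbb Z[F]$ put $D(n,\mathfrak a)=F\cap(1+\mathfrak a+\mathfrak f^n)$. Then: (i) $$D(3,\mathfrak f\mathfrak s)=\big\langle [x_i^{e_i},x_j] \;\big|\; 1\le i<j\le m\big\rangle\,\gamma_2(S)\,\gamma_3(F).$$ (ii) $$D(4,\mathfrak f\mathfrak s)=\Big\langle [x_i^{e_i},x_j]^{a_{ij}} \;\Big|\; 1\le i<j\le m,\ a_{ij}\in\mathbb Z,\ e_j\,\Big|\,\tfrac{e_i}{e_j}\tbinom{e_j}{2}a_{ij}\Big\rangle\,\gamma_2(S)\,\gamma_4(F).$$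 (If $e_j=0$ then $e_i=0$ for $i<j$, so $[x_i^{e_i},x_j]=1$ and the divisibility condition is regarded as void.) -/

import Mathlib

open scoped commutatorElement

noncomputable section

namespace GenDim

variable {F : Type*} [Group F]

/-- The term `γ_n(H)` of the lower central series of a subgroup `H` of `F`, as a subgroup of `F`,
indexed from `γ_1(H) = H` (Mathlib's series is indexed from `0`). -/
abbrev gamma (H : Subgroup F) (n : ℕ) : Subgroup F := H.lowerCentralSeries (n - 1)

/-- The augmentation homomorphism `ℤ[F] → ℤ`, `g ↦ 1`. -/
def augmentation (F : Type*) [Group F] : MonoidAlgebra ℤ F →+* ℤ :=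
  (MonoidAlgebra.lift ℤ ℤ F (1 : F →* ℤ)).toRingHom

/-- The augmentation ideal `𝔣` of `ℤ[F]`. -/
def augIdeal (F : Type*) [Group F] : Ideal (MonoidAlgebra ℤ F) := RingHom.ker (augmentation F)

/-- The ideal `ℤ[F] (H - 1)` of `ℤ[F]` generated by the elements `h - 1`, `h ∈ H`. It is
two-sided when `H` is normal, see `relIdeal_isTwoSided`. -/
def relIdeal (H : Subgroup F) : Ideal (MonoidAlgebra ℤ F) :=
  Ideal.span {u | ∃ h ∈ H, u = MonoidAlgebra.of ℤ F h - 1}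

theorem relIdeal_isTwoSided (H : Subgroup F) [hH : H.Normal] : (relIdeal H).IsTwoSided := by
  refine ⟨fun {a} b ha => ?_⟩
  induction b using MonoidAlgebra.induction_on with
  | of g =>
    refine Submodule.span_induction (p := fun a _ => a * MonoidAlgebra.of ℤ F g ∈ relIdeal H)
      ?_ ?_ ?_ ?_ ha
    · rintro _ ⟨h, hh, rfl⟩
      have e : (MonoidAlgebra.of ℤ F h - 1) * MonoidAlgebra.of ℤ F g
          = MonoidAlgebra.of ℤ F g * (MonoidAlgebra.of ℤ F (g⁻¹ * h * g) - 1) := by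
        simp only [sub_mul, mul_sub, ← map_mul, one_mul, mul_one]
        congr 2
        group
      rw [e]
      refine Ideal.mul_mem_left _ _ (Ideal.subset_span ⟨_, ?_, rfl⟩)
      simpa using hH.conj_mem h hh g⁻¹
    · simp
    · intro x y _ _ hx hy
      rw [add_mul]
      exact Ideal.add_mem _ hx hy
    · intro r x _ hx
      rw [smul_eq_mul, mul_assoc]
      exact Ideal.mul_mem_left _ _ hx
  | add f g hf hg =>
    rw [mul_add]
    exact Ideal.add_mem _ hf hg
  | smul r f hf =>
    rw [mul_smul_comm]
    exact Submodule.smul_of_tower_mem _ r hf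

/-- The generalized dimension subgroup `D(n, 𝔞) = F ∩ (1 + 𝔞 + 𝔣 ^ n)`. -/
def D (n : ℕ) (a : Ideal (MonoidAlgebra ℤ F)) : Subgroup F where
  carrier := {w | MonoidAlgebra.of ℤ F w - 1 ∈ a ⊔ augIdeal F ^ n}
  one_mem' := by
    rw [Set.mem_ofPred_eq, map_one, sub_self]
    exact Submodule.zero_mem _
  mul_mem' := by
    intro u v hu hv
    have e : MonoidAlgebra.of ℤ F (u * v) - 1 = MonoidAlgebra.of ℤ F u *
        (MonoidAlgebra.of ℤ F v - 1) + (MonoidAlgebra.of ℤ F u - 1) := by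
      rw [map_mul]
      noncomm_ring
    rw [Set.mem_ofPred_eq, e]
    exact Ideal.add_mem _ (Ideal.mul_mem_left _ _ hv) hu
  inv_mem' := by
    intro u hu
    have e : MonoidAlgebra.of ℤ F u⁻¹ - 1 = (-MonoidAlgebra.of ℤ F u⁻¹) *
        (MonoidAlgebra.of ℤ F u - 1) := by
      rw [mul_sub, neg_mul, ← map_mul, inv_mul_cancel, map_one, mul_one]
      abel
    rw [Set.mem_ofPred_eq, e]
    exact Ideal.mul_mem_left _ _ hu

/-- The subgroup `S = ⟨x_1 ^ e_1, …, x_m ^ e_m, γ_2(F)⟩`. -/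
def S {m : ℕ} (x : Fin m → F) (e : Fin m → ℕ) : Subgroup F :=
  Subgroup.closure (Set.range (fun i => x i ^ e i)) ⊔ gamma ⊤ 2

end GenDim

end

open scoped commutatorElement

noncomputable section

namespace GenDim

variable {F : Type*} [Group F]

/-- Mathlib's indexing of the lower central series of `F`, starting with `L 0 = F`. -/
local notation "L" => Subgroup.lowerCentralSeries (⊤ : Subgroup F)

theorem commutator_mem_lcs_succ {n : ℕ} {p : F} (hp : p ∈ L n) (v : F) : ⁅p, v⁆ ∈ L (n + 1) :=
  Subgroup.commutator_mem_commutator hp (Subgroup.mem_top v)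

theorem commutator_mem_lcs_succ' {n : ℕ} {p : F} (hp : p ∈ L n) (v : F) : ⁅v, p⁆ ∈ L (n + 1) := by
  rw [← commutatorElement_inv]
  exact inv_mem (commutator_mem_lcs_succ hp v)

theorem conj_eq_commutator_mul (g h : F) : g * h * g⁻¹ = ⁅g, h⁆ * h := by
  simp [commutatorElement_def]

theorem conj_mem_of_lcs_succ_le {n : ℕ} {W : Subgroup F} (hW : L (n + 1) ≤ W) {h : F}
    (hh : h ∈ L n) (hhW : h ∈ W) (g : F) : g * h * g⁻¹ ∈ W := by
  rw [conj_eq_commutator_mul]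
  exact mul_mem (hW (commutator_mem_lcs_succ' hh g)) hhW

/-- If `W` contains `γ_{n+3}`, the elements `p` of `γ_{n+1}` with `⁅p, v⁆ ∈ W` form a subgroup. -/
def leftCommutatorSubgroup (n : ℕ) (W : Subgroup F) (hW : L (n + 2) ≤ W) (v : F) : Subgroup F where
  carrier := {p | p ∈ L n ∧ ⁅p, v⁆ ∈ W}
  one_mem' := ⟨one_mem _, by simp⟩
  mul_mem' := by
    rintro p q ⟨hp, hpW⟩ ⟨hq, hqW⟩
    refine ⟨mul_mem hp hq, ?_⟩
    rw [commutatorElement_mul_left_eq_conj_mul]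
    exact mul_mem (conj_mem_of_lcs_succ_le hW (commutator_mem_lcs_succ hq v) hqW p) hpW
  inv_mem' := by
    rintro p ⟨hp, hpW⟩
    refine ⟨inv_mem hp, ?_⟩
    rw [commutatorElement_inv_left, ← commutatorElement_inv p v]
    simpa using conj_mem_of_lcs_succ_le hW (inv_mem (commutator_mem_lcs_succ hp v))
      (inv_mem hpW) p⁻¹

/-- If `W` contains `γ_{n+3}` and `p ∈ γ_{n+1}`, the elements `v` with `⁅p, v⁆ ∈ W` form a
subgroup. -/
def rightCommutatorSubgroup (n : ℕ) (W : Subgroup F) (hW : L (n + 2) ≤ W) (p : F)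
    (hp : p ∈ L n) : Subgroup F where
  carrier := {v | ⁅p, v⁆ ∈ W}
  one_mem' := by simp
  mul_mem' := by
    intro u v hu hv
    rw [Set.mem_ofPred_eq, commutatorElement_mul_right_eq_mul_conj, mul_assoc, mul_assoc,
      ← mul_assoc u]
    exact mul_mem hu (conj_mem_of_lcs_succ_le hW (commutator_mem_lcs_succ hp v) hv u)
  inv_mem' := by
    intro v hv
    rw [Set.mem_ofPred_eq, commutatorElement_inv_right, ← commutatorElement_inv p v]
    simpa using conj_mem_of_lcs_succ_le hW (inv_mem (commutator_mem_lcs_succ hp v))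
      (inv_mem hv) v⁻¹

/-- Commutators of generators of `γ_{n+1}` modulo `γ_{n+2}` with generators of `F` generate
`γ_{n+2}` modulo `γ_{n+3}`. -/
theorem lcs_succ_le_of_generators {n : ℕ} {W : Subgroup F} (hW : L (n + 2) ≤ W) {s X : Set F}
    (hX : Subgroup.closure X = ⊤) (hs : L n ≤ Subgroup.closure s ⊔ L (n + 1)) (hsn : s ⊆ L n)
    (h : ∀ a ∈ s, ∀ y ∈ X, ⁅a, y⁆ ∈ W) : L (n + 1) ≤ W := by
  rw [Subgroup.lowerCentralSeries_succ, Subgroup.commutator_le]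
  intro p hp v _
  have key : ∀ y ∈ X, ⁅p, y⁆ ∈ W := by
    intro y hy
    have h1 : Subgroup.closure s ⊔ L (n + 1) ≤ leftCommutatorSubgroup n W hW y := by
      refine sup_le ((Subgroup.closure_le _).2 fun a ha => ⟨hsn ha, h a ha y hy⟩) fun a ha => ?_
      exact ⟨Subgroup.lowerCentralSeries_antitone _ (Nat.le_succ n) ha,
        hW (commutator_mem_lcs_succ ha y)⟩
    exact (h1 (hs hp)).2
  have h2 : Subgroup.closure X ≤ rightCommutatorSubgroup n W hW p hp :=
    (Subgroup.closure_le _).2 key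
  exact h2 (hX ▸ Subgroup.mem_top v)

theorem commutator_lcs_one_lcs_one {p q : F} (hp : p ∈ L 1) (hq : q ∈ L 1) : ⁅p, q⁆ ∈ L 3 := by
  have key : ⁅L 1, L 1⁆ ≤ L 3 := by
    rw [Subgroup.commutator_le]
    intro p hp q hq
    induction hp using Subgroup.closure_induction with
    | mem x hx =>
      obtain ⟨a, -, b, -, rfl⟩ := hx
      have hr : b⁻¹ * q * b ∈ L 1 := by
        simpa using (inferInstance : (L 1).Normal).conj_mem q hq b⁻¹
      have e := commutatorElement_commutatorElement_conj_mul a b (b⁻¹ * q * b)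
      have e2 : b * (b⁻¹ * q * b) * b⁻¹ = q := by group
      rw [e2, mul_assoc] at e
      rw [eq_inv_of_mul_eq_one_left e]
      exact inv_mem (mul_mem (commutator_mem_lcs_succ (commutator_mem_lcs_succ' hr _) _)
        (commutator_mem_lcs_succ (commutator_mem_lcs_succ hr _) _))
    | one => simp
    | mul x y _ _ hx hy =>
      rw [commutatorElement_mul_left_eq_conj_mul]
      exact mul_mem ((inferInstance : (L 3).Normal).conj_mem _ hy x) hx
    | inv x _ hx =>
      rw [commutatorElement_inv_left, ← commutatorElement_inv x q]
      simpa using (inferInstance : (L 3).Normal).conj_mem _ (inv_mem hx) x⁻¹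
  exact key (Subgroup.commutator_mem_commutator hp hq)

theorem commutator_mul_right_mem_iff {W : Subgroup F} (hW : L 3 ≤ W) {p q : F} (hp : p ∈ L 1)
    (hq : q ∈ L 1) (a : F) : ⁅p, q * a⁆ ∈ W ↔ ⁅p, a⁆ ∈ W := by
  have hq' : q ∈ rightCommutatorSubgroup 1 W hW p hp := hW (commutator_lcs_one_lcs_one hp hq)
  exact Subgroup.mul_mem_cancel_left _ hq'

/-- The Jacobi identity modulo `γ_4`. -/
theorem commutator_commutator_mem_of_rotate {W : Subgroup F} (hW : L 3 ≤ W) {a b c : F}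
    (h1 : ⁅⁅b, c⁆, a⁆ ∈ W) (h2 : ⁅⁅c, a⁆, b⁆ ∈ W) : ⁅⁅a, b⁆, c⁆ ∈ W := by
  have hc : ∀ u v : F, ⁅u, v⁆ ∈ L 1 := fun u v =>
    commutator_mem_lcs_succ (n := 0) (Subgroup.mem_top u) v
  have e := commutatorElement_commutatorElement_conj_mul a b c
  rw [conj_eq_commutator_mul, conj_eq_commutator_mul, conj_eq_commutator_mul, mul_assoc] at e
  rw [← commutator_mul_right_mem_iff hW (hc a b) (hc b c), eq_inv_of_mul_eq_one_left e]
  exact inv_mem (mul_mem ((commutator_mul_right_mem_iff hW (hc _ _) (hc _ _) _).2 h1)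
    ((commutator_mul_right_mem_iff hW (hc _ _) (hc _ _) _).2 h2))

theorem commutator_swap_commutator_mem_iff {W : Subgroup F} (hW : L 3 ≤ W) {a b c : F} :
    ⁅⁅a, b⁆, c⁆ ∈ W ↔ ⁅⁅b, a⁆, c⁆ ∈ W := by
  have hc : ∀ u v : F, ⁅u, v⁆ ∈ L 1 := fun u v =>
    commutator_mem_lcs_succ (n := 0) (Subgroup.mem_top u) v
  have key : ∀ u v : F, ⁅⁅u, v⁆, c⁆ ∈ W → ⁅⁅v, u⁆, c⁆ ∈ W := by
    intro u v h
    have h' : ⁅u, v⁆ ∈ leftCommutatorSubgroup 1 W hW c := ⟨hc u v, h⟩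
    rw [← commutatorElement_inv u v]
    exact (inv_mem h').2
  exact ⟨key a b, key b a⟩

section Basis

variable {m : ℕ} (x : FreeGroupBasis (Fin m) F)

theorem closure_range_basis : Subgroup.closure (Set.range x) = ⊤ := by
  have h : Set.range x = x.repr.symm '' Set.range FreeGroup.of := by
    rw [← Set.range_comp]; rfl
  rw [h, ← MulEquiv.coe_toMonoidHom, ← MonoidHom.map_closure, FreeGroup.closure_range_of]
  exact Subgroup.map_top_of_surjective _ x.repr.symm.surjective

/-- The basic commutators of weight two. -/
def basicTwo (p : {p : Fin m × Fin m // p.1 < p.2}) : F := ⁅x p.1.1, x p.1.2⁆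

/-- The basic commutators of weight three. -/
def basicThree (p : {p : Fin m × Fin m × Fin m // p.2.1 < p.1 ∧ p.2.1 ≤ p.2.2}) : F :=
  ⁅⁅x p.1.1, x p.1.2.1⁆, x p.1.2.2⁆

theorem basicTwo_mem (p) : basicTwo x p ∈ L 1 :=
  commutator_mem_lcs_succ (n := 0) (Subgroup.mem_top _) _

theorem basicThree_mem (p) : basicThree x p ∈ L 2 :=
  commutator_mem_lcs_succ (commutator_mem_lcs_succ (n := 0) (Subgroup.mem_top _) _) _

theorem lcs_one_le : L 1 ≤ Subgroup.closure (Set.range (basicTwo x)) ⊔ L 2 := by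
  refine lcs_succ_le_of_generators (n := 0) le_sup_right (closure_range_basis x)
    (s := Set.range x) ?_ (fun _ _ => Subgroup.mem_top _) ?_
  · rw [closure_range_basis x]
    exact le_sup_of_le_left le_top
  · rintro _ ⟨a, rfl⟩ _ ⟨b, rfl⟩
    rcases lt_trichotomy a b with h | rfl | h
    · exact Subgroup.mem_sup_left (Subgroup.subset_closure ⟨⟨(a, b), h⟩, rfl⟩)
    · simp
    · rw [← commutatorElement_inv]
      exact inv_mem (Subgroup.mem_sup_left (Subgroup.subset_closure ⟨⟨(b, a), h⟩, rfl⟩))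

theorem lcs_two_le : L 2 ≤ Subgroup.closure (Set.range (basicThree x)) ⊔ L 3 := by
  have hW : L 3 ≤ Subgroup.closure (Set.range (basicThree x)) ⊔ L 3 := le_sup_right
  have basic : ∀ {a b c : Fin m}, b < a → b ≤ c →
      ⁅⁅x a, x b⁆, x c⁆ ∈ Subgroup.closure (Set.range (basicThree x)) ⊔ L 3 := fun {a b c} h h' =>
    Subgroup.mem_sup_left (Subgroup.subset_closure ⟨⟨(a, b, c), h, h'⟩, rfl⟩)
  refine lcs_succ_le_of_generators (n := 1) hW (closure_range_basis x) (lcs_one_le x) ?_ ?_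
  · rintro _ ⟨p, rfl⟩
    exact basicTwo_mem x p
  · rintro _ ⟨⟨⟨a, b⟩, hab⟩, rfl⟩ _ ⟨c, rfl⟩
    change ⁅⁅x a, x b⁆, x c⁆ ∈ _
    change a < b at hab
    rcases le_or_gt a c with h | h
    · rw [commutator_swap_commutator_mem_iff hW]
      exact basic hab h
    · refine commutator_commutator_mem_of_rotate hW (basic (h.trans hab) h.le) ?_
      rw [commutator_swap_commutator_mem_iff hW]
      exact basic h (h.trans hab).le

end Basis

/-- A dual-basis criterion: if `K / N` is abelian and generated by the images of finitely many
`t a`, with dual coordinates `C a`, then an element all of whose components `t a ^ C a g` lie in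
`R ≥ N` belongs to `R`. -/
theorem mem_of_coordinates {K N R : Subgroup F} (hNK : N ≤ K) (hK : ⁅K, K⁆ ≤ N) (hNR : N ≤ R)
    {ι : Type*} [Fintype ι] [DecidableEq ι] (t : ι → F) (ht : ∀ a, t a ∈ K)
    (hgen : K ≤ Subgroup.closure (Set.range t) ⊔ N) (C : ι → F → ℤ)
    (hmul : ∀ a, ∀ g ∈ K, ∀ h ∈ K, C a (g * h) = C a g + C a h) (hN : ∀ a, ∀ g ∈ N, C a g = 0)
    (hdual : ∀ a b, C a (t b) = if a = b then 1 else 0) {g : F} (hg : g ∈ K)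
    (hR : ∀ a, t a ^ C a g ∈ R) : g ∈ R := by
  have hnorm : (N.subgroupOf K).Normal := by
    refine ⟨fun n hn k => ?_⟩
    rw [Subgroup.mem_subgroupOf] at hn ⊢
    have e : ((k * n * k⁻¹ : K) : F) = ⁅(k : F), (n : F)⁆ * n := by
      simp [commutatorElement_def]
    rw [e]
    exact mul_mem (hK (Subgroup.commutator_mem_commutator k.2 n.2)) hn
  have hcomm : ∀ p q : K ⧸ N.subgroupOf K, p * q = q * p := by
    intro p q
    induction p using QuotientGroup.induction_on with | H p => ?_
    induction q using QuotientGroup.induction_on with | H q => ?_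
    rw [← commutatorElement_eq_one_iff_mul_comm]
    change ((⁅p, q⁆ : K) : K ⧸ N.subgroupOf K) = 1
    rw [QuotientGroup.eq_one_iff, Subgroup.mem_subgroupOf]
    exact hK (Subgroup.commutator_mem_commutator p.2 q.2)
  let _ : CommGroup (K ⧸ N.subgroupOf K) := { mul_comm := hcomm }
  let T : ι → K ⧸ N.subgroupOf K := fun a => ((⟨t a, ht a⟩ : K) : K ⧸ N.subgroupOf K)
  let φ : K →* K ⧸ N.subgroupOf K := QuotientGroup.mk' _
  let ψ : K →* K ⧸ N.subgroupOf K :=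
    { toFun := fun k => ∏ a, T a ^ C a k
      map_one' := by simp [hN _ 1 (one_mem N)]
      map_mul' := fun k l => by
        simp only [Subgroup.coe_mul, hmul _ _ k.2 _ l.2, zpow_add, Finset.prod_mul_distrib] }
  have hle : K ≤ (φ.eqLocus ψ).map K.subtype := by
    refine hgen.trans (sup_le ((Subgroup.closure_le _).2 ?_) fun n hn => ?_)
    · rintro _ ⟨b, rfl⟩
      refine ⟨⟨t b, ht b⟩, ?_, rfl⟩
      change T b = ∏ a, T a ^ C a (t b)
      simp [hdual]
    · refine ⟨⟨n, hNK hn⟩, ?_, rfl⟩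
      change φ _ = ∏ a, T a ^ C a n
      simp only [hN _ n hn, zpow_zero, Finset.prod_const_one]
      exact (QuotientGroup.eq_one_iff _).2 hn
  obtain ⟨k, hk, rfl⟩ := hle hg
  have hmem : φ k ∈ (R.subgroupOf K).map φ := by
    rw [show φ k = ψ k from hk]
    refine Subgroup.prod_mem _ fun a _ => ⟨⟨t a, ht a⟩ ^ C a k, ?_, ?_⟩
    · exact hR a
    · rw [map_zpow]; rfl
  obtain ⟨r, hr, hrk⟩ := hmem
  have h3 : r⁻¹ * k ∈ N.subgroupOf K := QuotientGroup.eq.1 hrk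
  have h4 : (r : F) * ((r⁻¹ * k : K) : F) ∈ R := mul_mem hr (hNR h3)
  simpa using h4

/-- The group of noncommutative power series with constant term `1`, truncated in degree `4`. -/
@[ext]
structure MagnusGroup (ι : Type*) where
  /-- coefficients of degree one -/
  one : ι → ℤ
  /-- coefficients of degree two -/
  two : ι → ι → ℤ
  /-- coefficients of degree three -/
  three : ι → ι → ι → ℤ

namespace MagnusGroup

variable {ι : Type*}

instance : Mul (MagnusGroup ι) :=
  ⟨fun u v => ⟨fun i => u.one i + v.one i,
    fun i j => u.two i j + u.one i * v.one j + v.two i j,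
    fun i j k => u.three i j k + u.two i j * v.one k + u.one i * v.two j k + v.three i j k⟩⟩

instance : One (MagnusGroup ι) := ⟨⟨fun _ => 0, fun _ _ => 0, fun _ _ _ => 0⟩⟩

instance : Inv (MagnusGroup ι) :=
  ⟨fun u => ⟨fun i => -u.one i, fun i j => u.one i * u.one j - u.two i j,
    fun i j k => u.two i j * u.one k + u.one i * u.two j k - u.one i * u.one j * u.one k
      - u.three i j k⟩⟩

theorem mul_one_coeff (u v : MagnusGroup ι) (i) : (u * v).one i = u.one i + v.one i := rfl

theorem mul_two (u v : MagnusGroup ι) (i j) :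
    (u * v).two i j = u.two i j + u.one i * v.one j + v.two i j := rfl

theorem mul_three (u v : MagnusGroup ι) (i j k) :
    (u * v).three i j k
      = u.three i j k + u.two i j * v.one k + u.one i * v.two j k + v.three i j k := rfl

theorem one_one (i : ι) : (1 : MagnusGroup ι).one i = 0 := rfl

theorem one_two (i j : ι) : (1 : MagnusGroup ι).two i j = 0 := rfl

theorem one_three (i j k : ι) : (1 : MagnusGroup ι).three i j k = 0 := rfl

theorem inv_one_coeff (u : MagnusGroup ι) (i) : u⁻¹.one i = -u.one i := rfl

theorem inv_two (u : MagnusGroup ι) (i j) : u⁻¹.two i j = u.one i * u.one j - u.two i j := rfl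

theorem inv_three (u : MagnusGroup ι) (i j k) :
    u⁻¹.three i j k = u.two i j * u.one k + u.one i * u.two j k - u.one i * u.one j * u.one k
      - u.three i j k := rfl

instance : Group (MagnusGroup ι) :=
  Group.ofLeftAxioms
    (fun u v w => by
      ext <;> simp only [mul_one_coeff, mul_two, mul_three] <;> ring)
    (fun u => by
      ext <;> simp only [mul_one_coeff, mul_two, mul_three, one_one, one_two, one_three] <;> ring)
    (fun u => by
      ext <;> simp only [mul_one_coeff, mul_two, mul_three, one_one, one_two, one_three,
        inv_one_coeff, inv_two, inv_three] <;> ring)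

end MagnusGroup

theorem basis_induction {ι : Type*} (x : FreeGroupBasis ι F) {P : F → Prop} (hx : ∀ i, P (x i)) (hone : P 1)
    (hmul : ∀ g h, P g → P h → P (g * h)) (hinv : ∀ g, P g → P g⁻¹) (g : F) : P g := by
  let H : Subgroup F := ⟨⟨⟨P, fun {a b} => hmul a b⟩, hone⟩, fun {a} => hinv a⟩
  let f : F →* H := x.lift fun i => ⟨x i, hx i⟩
  have h : H.subtype.comp f = MonoidHom.id F := x.ext_hom _ _ fun i =>
    congrArg Subtype.val (congrFun (x.lift.symm_apply_apply fun i => (⟨x i, hx i⟩ : H)) i)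
  have h2 : ((f g : H) : F) = g := DFunLike.congr_fun h g
  exact h2 ▸ (f g).2

section Coefficients

variable {ι : Type*} [DecidableEq ι] (x : FreeGroupBasis ι F)

/-- The truncated Magnus homomorphism, sending `x i` to `1 + X i`. -/
def magnus : F →* MagnusGroup ι :=
  x.lift fun i => ⟨fun j => if j = i then 1 else 0, fun _ _ => 0, fun _ _ _ => 0⟩

/-- The coefficient of `X i`. -/
def c₁ (i : ι) (g : F) : ℤ := (magnus x g).one i

/-- The coefficient of `X i * X j`. -/
def c₂ (i j : ι) (g : F) : ℤ := (magnus x g).two i j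

/-- The coefficient of `X i * X j * X k`. -/
def c₃ (i j k : ι) (g : F) : ℤ := (magnus x g).three i j k

theorem magnus_basis (i : ι) : magnus x (x i)
    = ⟨fun j => if j = i then 1 else 0, fun _ _ => 0, fun _ _ _ => 0⟩ :=
  congrFun (x.lift.symm_apply_apply _) i

theorem c₁_basis (i j : ι) : c₁ x i (x j) = if i = j then 1 else 0 := by
  rw [c₁, magnus_basis]

theorem c₂_basis (i j k : ι) : c₂ x i j (x k) = 0 := by
  rw [c₂, magnus_basis]

theorem c₃_basis (i j k l : ι) : c₃ x i j k (x l) = 0 := by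
  rw [c₃, magnus_basis]

theorem c₁_mul (i : ι) (g h : F) : c₁ x i (g * h) = c₁ x i g + c₁ x i h := by
  simp only [c₁, map_mul, MagnusGroup.mul_one_coeff]

theorem c₂_mul (i j : ι) (g h : F) :
    c₂ x i j (g * h) = c₂ x i j g + c₁ x i g * c₁ x j h + c₂ x i j h := by
  simp only [c₁, c₂, map_mul, MagnusGroup.mul_two]

theorem c₃_mul (i j k : ι) (g h : F) : c₃ x i j k (g * h)
    = c₃ x i j k g + c₂ x i j g * c₁ x k h + c₁ x i g * c₂ x j k h + c₃ x i j k h := by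
  simp only [c₁, c₂, c₃, map_mul, MagnusGroup.mul_three]

theorem c₁_one (i : ι) : c₁ x i 1 = 0 := by
  rw [c₁, map_one]; rfl

theorem c₂_one (i j : ι) : c₂ x i j 1 = 0 := by
  rw [c₂, map_one]; rfl

theorem c₃_one (i j k : ι) : c₃ x i j k 1 = 0 := by
  rw [c₃, map_one]; rfl

theorem c₁_inv (i : ι) (g : F) : c₁ x i g⁻¹ = -c₁ x i g := by
  simp only [c₁, map_inv, MagnusGroup.inv_one_coeff]

theorem c₂_inv (i j : ι) (g : F) : c₂ x i j g⁻¹ = c₁ x i g * c₁ x j g - c₂ x i j g := by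
  simp only [c₁, c₂, map_inv, MagnusGroup.inv_two]

theorem c₃_inv (i j k : ι) (g : F) : c₃ x i j k g⁻¹ = c₂ x i j g * c₁ x k g
    + c₁ x i g * c₂ x j k g - c₁ x i g * c₁ x j g * c₁ x k g - c₃ x i j k g := by
  simp only [c₁, c₂, c₃, map_inv, MagnusGroup.inv_three]

/-- The coefficient of `X i` as a homomorphism. -/
def c₁Hom (i : ι) : F →* Multiplicative ℤ where
  toFun g := Multiplicative.ofAdd (c₁ x i g)
  map_one' := by rw [c₁_one]; rfl
  map_mul' g h := by rw [c₁_mul]; rfl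

theorem c₁_pow (i : ι) (g : F) (n : ℕ) : c₁ x i (g ^ n) = n * c₁ x i g := by
  induction n with
  | zero => simp [c₁_one]
  | succ n ih => rw [pow_succ, c₁_mul, ih]; push_cast; ring

theorem c₁_commutator (i : ι) (g h : F) : c₁ x i ⁅g, h⁆ = 0 := by
  simp only [commutatorElement_def, c₁_mul, c₁_inv]; ring

theorem c₂_commutator (i j : ι) (g h : F) :
    c₂ x i j ⁅g, h⁆ = c₁ x i g * c₁ x j h - c₁ x i h * c₁ x j g := by
  simp only [commutatorElement_def, c₁_mul, c₁_inv, c₂_mul, c₂_inv]; ring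

theorem c₃_commutator (i j k : ι) {g : F} (hg : ∀ l, c₁ x l g = 0) (h : F) :
    c₃ x i j k ⁅g, h⁆ = c₂ x i j g * c₁ x k h - c₁ x i h * c₂ x j k g := by
  simp only [commutatorElement_def, c₁_mul, c₁_inv, c₂_mul, c₂_inv, c₃_mul, c₃_inv, hg]; ring

theorem c₁_eq_zero {g : F} (hg : g ∈ L 1) (i : ι) : c₁ x i g = 0 := by
  have h : L 1 ≤ (c₁Hom x i).ker := by
    rw [Subgroup.lowerCentralSeries_succ, Subgroup.commutator_le]
    intro p _ q _
    exact congrArg Multiplicative.ofAdd (c₁_commutator x i p q)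
  exact congrArg Multiplicative.toAdd (h hg)

theorem c₂_eq_zero {g : F} (hg : g ∈ L 2) (i j : ι) : c₂ x i j g = 0 := by
  have hc : ∀ {g : F}, g ∈ L 2 → ∀ i, c₁ x i g = 0 := fun hg i =>
    c₁_eq_zero x (Subgroup.lowerCentralSeries_antitone _ (by simp) hg) i
  induction hg using Subgroup.closure_induction with
  | mem _ hg =>
    obtain ⟨p, hp, q, -, rfl⟩ := hg
    rw [c₂_commutator, c₁_eq_zero x hp, c₁_eq_zero x hp]; ring
  | one => exact c₂_one x i j
  | mul p q hp hq ihp ihq => rw [c₂_mul, ihp, ihq, hc hp]; ring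
  | inv p hp ihp => rw [c₂_inv, ihp, hc hp]; ring

theorem c₃_eq_zero {g : F} (hg : g ∈ L 3) (i j k : ι) : c₃ x i j k g = 0 := by
  have hc : ∀ {g : F}, g ∈ L 3 → ∀ i, c₁ x i g = 0 := fun hg i =>
    c₁_eq_zero x (Subgroup.lowerCentralSeries_antitone _ (by simp) hg) i
  have hc2 : ∀ {g : F}, g ∈ L 3 → ∀ i j, c₂ x i j g = 0 := fun hg i j =>
    c₂_eq_zero x (Subgroup.lowerCentralSeries_antitone _ (by simp) hg) i j
  induction hg using Subgroup.closure_induction with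
  | mem _ hg =>
    obtain ⟨p, hp, q, -, rfl⟩ := hg
    have hp1 : p ∈ L 1 := Subgroup.lowerCentralSeries_antitone _ (by simp) hp
    rw [c₃_commutator _ _ _ _ (c₁_eq_zero x hp1), c₂_eq_zero x hp, c₂_eq_zero x hp]; ring
  | one => exact c₃_one x i j k
  | mul p q hp hq ihp ihq => simp only [c₃_mul, ihp, ihq, hc hp, hc2 hp]; ring
  | inv p hp ihp => simp only [c₃_inv, ihp, hc hp, hc2 hp]; ring

theorem c₂_shuffle {i j : ι} (hij : i ≠ j) (g : F) :
    c₂ x i j g + c₂ x j i g = c₁ x i g * c₁ x j g := by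
  induction g using basis_induction x with
  | hx k =>
    simp only [c₂_basis, c₁_basis]
    by_cases h : i = k
    · subst h; simp [hij.symm]
    · simp [h]
  | hone => simp [c₁_one, c₂_one]
  | hmul g h hg hh => simp only [c₁_mul, c₂_mul]; linear_combination hg + hh
  | hinv g hg => simp only [c₁_inv, c₂_inv]; linear_combination -hg

theorem two_mul_c₂_self (i : ι) (g : F) : 2 * c₂ x i i g = c₁ x i g * (c₁ x i g - 1) := by
  induction g using basis_induction x with
  | hx k => simp only [c₂_basis, c₁_basis]; split_ifs <;> simp
  | hone => simp [c₁_one, c₂_one]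
  | hmul g h hg hh => simp only [c₁_mul, c₂_mul]; linear_combination hg + hh
  | hinv g hg => simp only [c₁_inv, c₂_inv]; linear_combination -hg

theorem c₃_shuffle {i j : ι} (hij : i ≠ j) (g : F) :
    c₃ x i j j g + c₃ x j i j g + c₃ x j j i g = c₁ x i g * c₂ x j j g := by
  induction g using basis_induction x with
  | hx k => simp only [c₂_basis, c₃_basis]; simp
  | hone => simp [c₁_one, c₂_one, c₃_one]
  | hmul g h hg hh =>
    simp only [c₁_mul, c₂_mul, c₃_mul]
    linear_combination hg + hh + c₁ x j h * c₂_shuffle x hij g + c₁ x j g * c₂_shuffle x hij h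
  | hinv g hg =>
    simp only [c₁_inv, c₂_inv, c₃_inv]
    linear_combination -hg + 2 * c₁ x j g * c₂_shuffle x hij g

end Coefficients

section GroupRing

instance : (augIdeal F).IsTwoSided := inferInstanceAs (RingHom.ker (augmentation F)).IsTwoSided

theorem of_sub_one_mem (g : F) : MonoidAlgebra.of ℤ F g - 1 ∈ augIdeal F := by
  rw [augIdeal, RingHom.mem_ker, map_sub, map_one]
  simp [augmentation]

/-- The `ℤ`-linear extension of a function on `F` to `ℤ[F]`. -/
def extend (φ : F → ℤ) : MonoidAlgebra ℤ F →ₗ[ℤ] ℤ :=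
  (Finsupp.linearCombination ℤ φ).comp (MonoidAlgebra.coeffLinearEquiv ℤ).toLinearMap

theorem extend_of (φ : F → ℤ) (g : F) : extend φ (MonoidAlgebra.of ℤ F g) = φ g := by
  simp [extend]

theorem augmentation_of (g : F) : augmentation F (MonoidAlgebra.of ℤ F g) = 1 := by
  simp [augmentation]

/-- Two biadditive functions on `ℤ[F]` agree if they agree on `F × F`. -/
theorem biadditive_ext {f g : MonoidAlgebra ℤ F → MonoidAlgebra ℤ F → ℤ}
    (hf : ∀ u, ∀ v w, f u (v + w) = f u v + f u w) (hf' : ∀ u v w, f (u + v) w = f u w + f v w)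
    (hg : ∀ u, ∀ v w, g u (v + w) = g u v + g u w) (hg' : ∀ u v w, g (u + v) w = g u w + g v w)
    (h : ∀ a b, f (MonoidAlgebra.of ℤ F a) (MonoidAlgebra.of ℤ F b)
      = g (MonoidAlgebra.of ℤ F a) (MonoidAlgebra.of ℤ F b)) (u v : MonoidAlgebra ℤ F) :
    f u v = g u v := by
  let φ : MonoidAlgebra ℤ F →+ MonoidAlgebra ℤ F →+ ℤ :=
    AddMonoidHom.mk' (fun u => AddMonoidHom.mk' (f u) (hf u)) fun u v => by
      refine AddMonoidHom.ext fun w => ?_; exact hf' u v w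
  let ψ : MonoidAlgebra ℤ F →+ MonoidAlgebra ℤ F →+ ℤ :=
    AddMonoidHom.mk' (fun u => AddMonoidHom.mk' (g u) (hg u)) fun u v => by
      refine AddMonoidHom.ext fun w => ?_; exact hg' u v w
  change φ u v = ψ u v
  induction u using MonoidAlgebra.induction_on with
  | of a =>
    induction v using MonoidAlgebra.induction_on with
    | of b => exact h a b
    | add v w hv hw => rw [map_add, map_add, hv, hw]
    | smul r v hv => rw [map_zsmul, map_zsmul, hv]
  | add u w hu hw => rw [map_add, map_add, AddMonoidHom.add_apply, AddMonoidHom.add_apply, hu, hw]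
  | smul r u hu =>
    rw [map_zsmul, map_zsmul, AddMonoidHom.coe_smul, AddMonoidHom.coe_smul, Pi.smul_apply,
      Pi.smul_apply, hu]

variable {ι : Type*} [DecidableEq ι] (x : FreeGroupBasis ι F)

/-- The coefficient of `X i`, on the group ring. -/
def C₁ (i : ι) : MonoidAlgebra ℤ F →ₗ[ℤ] ℤ := extend (c₁ x i)

/-- The coefficient of `X i * X j`, on the group ring. -/
def C₂ (i j : ι) : MonoidAlgebra ℤ F →ₗ[ℤ] ℤ := extend (c₂ x i j)

/-- The coefficient of `X i * X j * X k`, on the group ring. -/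
def C₃ (i j k : ι) : MonoidAlgebra ℤ F →ₗ[ℤ] ℤ := extend (c₃ x i j k)

theorem C₁_mul (i : ι) (u v : MonoidAlgebra ℤ F) :
    C₁ x i (u * v) = C₁ x i u * augmentation F v + augmentation F u * C₁ x i v := by
  refine biadditive_ext (f := fun u v => C₁ x i (u * v))
    (g := fun u v => C₁ x i u * augmentation F v + augmentation F u * C₁ x i v) ?_ ?_ ?_ ?_ ?_ u v
  · intro u v w; simp only [mul_add, map_add]
  · intro u v w; simp only [add_mul, map_add]
  · intro u v w; simp only [map_add]; ring
  · intro u v w; simp only [map_add]; ring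
  · intro a b
    simp only [← map_mul, C₁, extend_of, c₁_mul, augmentation_of]; ring

theorem C₂_mul (i j : ι) (u v : MonoidAlgebra ℤ F) :
    C₂ x i j (u * v) = C₂ x i j u * augmentation F v + C₁ x i u * C₁ x j v
      + augmentation F u * C₂ x i j v := by
  refine biadditive_ext (f := fun u v => C₂ x i j (u * v))
    (g := fun u v => C₂ x i j u * augmentation F v + C₁ x i u * C₁ x j v
      + augmentation F u * C₂ x i j v) ?_ ?_ ?_ ?_ ?_ u v
  · intro u v w; simp only [mul_add, map_add]
  · intro u v w; simp only [add_mul, map_add]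
  · intro u v w; simp only [map_add]; ring
  · intro u v w; simp only [map_add]; ring
  · intro a b
    simp only [← map_mul, C₁, C₂, extend_of, c₂_mul, augmentation_of]; ring

theorem C₃_mul (i j k : ι) (u v : MonoidAlgebra ℤ F) :
    C₃ x i j k (u * v) = C₃ x i j k u * augmentation F v + C₂ x i j u * C₁ x k v
      + C₁ x i u * C₂ x j k v + augmentation F u * C₃ x i j k v := by
  refine biadditive_ext (f := fun u v => C₃ x i j k (u * v))
    (g := fun u v => C₃ x i j k u * augmentation F v + C₂ x i j u * C₁ x k v
      + C₁ x i u * C₂ x j k v + augmentation F u * C₃ x i j k v) ?_ ?_ ?_ ?_ ?_ u v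
  · intro u v w; simp only [mul_add, map_add]
  · intro u v w; simp only [add_mul, map_add]
  · intro u v w; simp only [map_add]; ring
  · intro u v w; simp only [map_add]; ring
  · intro a b
    simp only [← map_mul, C₁, C₂, C₃, extend_of, c₃_mul, augmentation_of]; ring

theorem C₁_of_sub_one (i : ι) (g : F) : C₁ x i (MonoidAlgebra.of ℤ F g - 1) = c₁ x i g := by
  rw [← map_one (MonoidAlgebra.of ℤ F), map_sub, C₁, extend_of, extend_of, c₁_one, sub_zero]

theorem C₂_of_sub_one (i j : ι) (g : F) :
    C₂ x i j (MonoidAlgebra.of ℤ F g - 1) = c₂ x i j g := by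
  rw [← map_one (MonoidAlgebra.of ℤ F), map_sub, C₂, extend_of, extend_of, c₂_one, sub_zero]

theorem C₃_of_sub_one (i j k : ι) (g : F) :
    C₃ x i j k (MonoidAlgebra.of ℤ F g - 1) = c₃ x i j k g := by
  rw [← map_one (MonoidAlgebra.of ℤ F), map_sub, C₃, extend_of, extend_of, c₃_one, sub_zero]

/-- An additive map that vanishes on products from `𝔞` and `𝔟` vanishes on `𝔞 𝔟`, and likewise
modulo an integer. -/
theorem dvd_of_mem_mul {I J : Ideal (MonoidAlgebra ℤ F)} (φ : MonoidAlgebra ℤ F →ₗ[ℤ] ℤ) (d : ℤ)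
    (h : ∀ u ∈ I, ∀ v ∈ J, d ∣ φ (u * v)) {w : MonoidAlgebra ℤ F} (hw : w ∈ I * J) : d ∣ φ w := by
  refine Submodule.smul_induction_on (p := fun w => d ∣ φ w) hw h fun u v hu hv => ?_
  rw [map_add]
  exact dvd_add hu hv

theorem augmentation_eq_zero {u : MonoidAlgebra ℤ F} (hu : u ∈ augIdeal F) :
    augmentation F u = 0 := hu

theorem mem_augIdeal_of_mem_pow {n : ℕ} {u : MonoidAlgebra ℤ F} (hu : u ∈ augIdeal F ^ (n + 1)) :
    u ∈ augIdeal F := Ideal.pow_le_self (Nat.succ_ne_zero n) hu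

theorem C₁_eq_zero {u : MonoidAlgebra ℤ F} (hu : u ∈ augIdeal F ^ 2) (i : ι) : C₁ x i u = 0 := by
  rw [Submodule.pow_succ, Submodule.pow_one] at hu
  refine zero_dvd_iff.1 (dvd_of_mem_mul _ 0 (fun u hu v hv => ?_) hu)
  rw [C₁_mul, augmentation_eq_zero hu, augmentation_eq_zero hv]; simp

theorem C₂_eq_zero {u : MonoidAlgebra ℤ F} (hu : u ∈ augIdeal F ^ 3) (i j : ι) :
    C₂ x i j u = 0 := by
  rw [Submodule.pow_succ] at hu
  refine zero_dvd_iff.1 (dvd_of_mem_mul _ 0 (fun u hu v hv => ?_) hu)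
  rw [C₂_mul, C₁_eq_zero x hu, augmentation_eq_zero hv,
    augmentation_eq_zero (mem_augIdeal_of_mem_pow hu)]; simp

theorem C₃_eq_zero {u : MonoidAlgebra ℤ F} (hu : u ∈ augIdeal F ^ 4) (i j k : ι) :
    C₃ x i j k u = 0 := by
  rw [Submodule.pow_succ] at hu
  refine zero_dvd_iff.1 (dvd_of_mem_mul _ 0 (fun u hu v hv => ?_) hu)
  rw [C₃_mul, C₂_eq_zero x hu, C₁_eq_zero x (Ideal.pow_le_pow_right (by simp) hu),
    augmentation_eq_zero hv, augmentation_eq_zero (mem_augIdeal_of_mem_pow hu)]; simp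

end GroupRing

section Necessary

variable {m : ℕ} (x : FreeGroupBasis (Fin m) F) (e : Fin m → ℕ)

theorem dvd_c₁ {s : F} (hs : s ∈ S x e) (i : Fin m) : (e i : ℤ) ∣ c₁ x i s := by
  let H : Subgroup F := (AddSubgroup.zmultiples (e i : ℤ)).toSubgroup.comap (c₁Hom x i)
  have hH : ∀ g, g ∈ H ↔ (e i : ℤ) ∣ c₁ x i g := fun g => Int.mem_zmultiples_iff
  refine (hH s).1 ((sup_le ((Subgroup.closure_le _).2 ?_) fun g hg => ?_ : S x e ≤ H) hs)
  · rintro _ ⟨j, rfl⟩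
    refine (hH _).2 ?_
    rw [c₁_pow, c₁_basis]
    split_ifs with h
    · subst h; simp
    · simp
  · exact (hH g).2 (by rw [c₁_eq_zero x hg]; exact dvd_zero _)

theorem augmentation_eq_zero_of_mem_relIdeal {H : Subgroup F} {v : MonoidAlgebra ℤ F}
    (hv : v ∈ relIdeal H) : augmentation F v = 0 := by
  have h : relIdeal H ≤ augIdeal F := Ideal.span_le.2 fun v ⟨s, _, hv⟩ => hv ▸ of_sub_one_mem s
  exact h hv

/-- Congruences for the coefficients of the elements of the ideal of `S`. -/
theorem relIdeal_congruences {v : MonoidAlgebra ℤ F} (hv : v ∈ relIdeal (S x e))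
    (he : ∀ i j : Fin m, i ≤ j → e j ∣ e i) :
    (∀ i, (e i : ℤ) ∣ C₁ x i v) ∧ (∀ i j, i < j → (e j : ℤ) ∣ C₂ x i j v + C₂ x j i v) ∧
      ∀ i, 2 * (e i : ℤ) ∣ 2 * C₂ x i i v - (e i - 1) * C₁ x i v := by
  have he' : ∀ {i j : Fin m}, i < j → (e j : ℤ) ∣ e i := fun h =>
    Int.natCast_dvd_natCast.2 (he _ _ h.le)
  have hle : ∀ v ∈ relIdeal (S x e), augmentation F v = 0 ∧ (∀ i, (e i : ℤ) ∣ C₁ x i v) ∧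
      (∀ i j, i < j → (e j : ℤ) ∣ C₂ x i j v + C₂ x j i v) ∧
      ∀ i, 2 * (e i : ℤ) ∣ 2 * C₂ x i i v - (e i - 1) * C₁ x i v := by
    intro v hv
    induction hv using Submodule.span_induction with
    | mem v hv =>
      obtain ⟨s, hs, rfl⟩ := hv
      simp only [C₁_of_sub_one, C₂_of_sub_one]
      refine ⟨of_sub_one_mem s, dvd_c₁ x e hs, fun i j hij => ?_, fun i => ?_⟩
      · rw [c₂_shuffle x hij.ne]
        exact Dvd.dvd.mul_left (dvd_c₁ x e hs j) _
      · rw [two_mul_c₂_self]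
        obtain ⟨t, ht⟩ := dvd_c₁ x e hs i
        obtain ⟨r, hr⟩ := (Int.even_mul_pred_self t).two_dvd
        rw [ht]
        exact ⟨e i * r, by linear_combination (e i : ℤ) ^ 2 * hr⟩
    | zero => simp
    | add u v _ _ hu hv =>
      simp only [map_add]
      refine ⟨by rw [hu.1, hv.1, add_zero], fun i => dvd_add (hu.2.1 i) (hv.2.1 i),
        fun i j hij => ?_, fun i => ?_⟩
      · exact (dvd_add (hu.2.2.1 i j hij) (hv.2.2.1 i j hij)).trans (dvd_of_eq (by ring))
      · exact (dvd_add (hu.2.2.2 i) (hv.2.2.2 i)).trans (dvd_of_eq (by ring))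
    | smul r v _ hv =>
      simp only [smul_eq_mul, map_mul, C₁_mul, C₂_mul, hv.1, mul_zero, zero_add, true_and]
      refine ⟨fun i => Dvd.dvd.mul_left (hv.2.1 i) _, fun i j hij => ?_, fun i => ?_⟩
      · have h := dvd_add (Dvd.dvd.mul_left (hv.2.2.1 i j hij) (augmentation F r))
          (dvd_add (Dvd.dvd.mul_left (hv.2.1 j) (C₁ x i r))
            (Dvd.dvd.mul_left ((he' hij).trans (hv.2.1 i)) (C₁ x j r)))
        exact h.trans (dvd_of_eq (by ring))
      · have h := dvd_add (Dvd.dvd.mul_left (hv.2.2.2 i) (augmentation F r))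
          (Dvd.dvd.mul_left (mul_dvd_mul_left 2 (hv.2.1 i)) (C₁ x i r))
        exact h.trans (dvd_of_eq (by ring))
  exact (hle v hv).2

theorem dvd_of_mem_D {n : ℕ} {I : Ideal (MonoidAlgebra ℤ F)} (φ : MonoidAlgebra ℤ F →ₗ[ℤ] ℤ)
    (d : ℤ) (hI : ∀ u ∈ augIdeal F, ∀ v ∈ I, d ∣ φ (u * v)) (hn : ∀ u ∈ augIdeal F ^ n, φ u = 0)
    {w : F} (hw : w ∈ D n (augIdeal F * I)) : d ∣ φ (MonoidAlgebra.of ℤ F w - 1) := by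
  obtain ⟨a, ha, b, hb, hab⟩ := Submodule.mem_sup.1 hw
  rw [← hab, map_add, hn b hb, add_zero]
  exact dvd_of_mem_mul φ d hI ha

theorem D_mono {k n : ℕ} (h : k ≤ n) (I : Ideal (MonoidAlgebra ℤ F)) : D n I ≤ D k I :=
  fun _ hw => sup_le_sup_left (Ideal.pow_le_pow_right h) I hw

/-- Elements of `D(2, 𝔣𝔰)` have no linear part. -/
theorem c₁_eq_zero_of_mem_D {w : F} (hw : w ∈ D 2 (augIdeal F * relIdeal (S x e))) (i : Fin m) :
    c₁ x i w = 0 := by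
  rw [← C₁_of_sub_one]
  refine zero_dvd_iff.1 (dvd_of_mem_D _ _ (fun u hu v hv => ?_) (fun u hu => C₁_eq_zero x hu i) hw)
  rw [C₁_mul, augmentation_eq_zero hu, augmentation_eq_zero_of_mem_relIdeal hv]; simp

theorem dvd_c₂_of_mem_D (he : ∀ i j : Fin m, i ≤ j → e j ∣ e i) {w : F}
    (hw : w ∈ D 3 (augIdeal F * relIdeal (S x e))) (i j : Fin m) : (e j : ℤ) ∣ c₂ x i j w := by
  rw [← C₂_of_sub_one]
  refine dvd_of_mem_D _ _ (fun u hu v hv => ?_) (fun u hu => C₂_eq_zero x hu i j) hw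
  rw [C₂_mul, augmentation_eq_zero hu, augmentation_eq_zero_of_mem_relIdeal hv]
  simpa using Dvd.dvd.mul_left ((relIdeal_congruences x e hv he).1 j) _

theorem dvd_c₃_of_mem_D (he : ∀ i j : Fin m, i ≤ j → e j ∣ e i) {w : F}
    (hw : w ∈ D 4 (augIdeal F * relIdeal (S x e))) (k : Fin m) {i j : Fin m} (hij : i < j) :
    (e j : ℤ) ∣ c₃ x k i j w + c₃ x k j i w := by
  rw [← C₃_of_sub_one, ← C₃_of_sub_one, ← LinearMap.add_apply]
  refine dvd_of_mem_D _ _ (fun u hu v hv => ?_) (fun u hu => ?_) hw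
  · obtain ⟨h1, h2, -⟩ := relIdeal_congruences x e hv he
    rw [LinearMap.add_apply, C₃_mul, C₃_mul, augmentation_eq_zero hu,
      augmentation_eq_zero_of_mem_relIdeal hv]
    have he' : (e j : ℤ) ∣ e i := Int.natCast_dvd_natCast.2 (he _ _ hij.le)
    have h := dvd_add (Dvd.dvd.mul_left (h2 i j hij) (C₁ x k u))
      (dvd_add (Dvd.dvd.mul_left (h1 j) (C₂ x k i u))
        (Dvd.dvd.mul_left (he'.trans (h1 i)) (C₂ x k j u)))
    exact h.trans (dvd_of_eq (by ring))
  · rw [LinearMap.add_apply, C₃_eq_zero x hu, C₃_eq_zero x hu, add_zero]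

theorem dvd_c₃_self_of_mem_D (he : ∀ i j : Fin m, i ≤ j → e j ∣ e i) {w : F}
    (hw : w ∈ D 4 (augIdeal F * relIdeal (S x e))) (k i : Fin m) :
    2 * (e i : ℤ) ∣ 2 * c₃ x k i i w - (e i - 1) * c₂ x k i w := by
  have key := dvd_of_mem_D ((2 : ℤ) • C₃ x k i i - ((e i : ℤ) - 1) • C₂ x k i) (2 * (e i : ℤ))
    (I := relIdeal (S x e)) (n := 4) (fun u hu v hv => ?_) (fun u hu => ?_) hw
  · simpa only [LinearMap.sub_apply, LinearMap.smul_apply, smul_eq_mul, C₂_of_sub_one,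
      C₃_of_sub_one] using key
  · obtain ⟨h1, -, h3⟩ := relIdeal_congruences x e hv he
    simp only [LinearMap.sub_apply, LinearMap.smul_apply, smul_eq_mul]
    rw [C₃_mul, C₂_mul, augmentation_eq_zero hu, augmentation_eq_zero_of_mem_relIdeal hv]
    have h := dvd_add (Dvd.dvd.mul_left (h3 i) (C₁ x k u))
      (Dvd.dvd.mul_left (mul_dvd_mul_left 2 (h1 i)) (C₂ x k i u))
    exact h.trans (dvd_of_eq (by ring))
  · simp only [LinearMap.sub_apply, LinearMap.smul_apply, smul_eq_mul]
    rw [C₃_eq_zero x hu, C₂_eq_zero x (Ideal.pow_le_pow_right (by simp) hu)]; simp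

end Necessary

section CoordinatesInGamma

variable {m : ℕ} (x : FreeGroupBasis (Fin m) F)

theorem mem_lcs_one_of_c₁_eq_zero {g : F} (h : ∀ i, c₁ x i g = 0) : g ∈ L 1 := by
  refine mem_of_coordinates (K := ⊤) (N := L 1) le_top le_rfl le_rfl x
    (fun _ => Subgroup.mem_top _) ?_ (c₁ x) (fun i g _ h _ => c₁_mul x i g h)
    (fun i g hg => c₁_eq_zero x hg i) (c₁_basis x) (Subgroup.mem_top g) fun i => ?_
  · rw [closure_range_basis x]
    exact le_sup_left
  · rw [h, zpow_zero]
    exact one_mem _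

theorem mem_of_coordinates_two {R : Subgroup F} (hR : L 2 ≤ R) {g : F} (hg : g ∈ L 1)
    (h : ∀ i j : Fin m, i < j → ⁅x i, x j⁆ ^ c₂ x i j g ∈ R) : g ∈ R := by
  refine mem_of_coordinates (Subgroup.lowerCentralSeries_antitone _ (by simp))
    (Subgroup.commutator_mono le_rfl le_top) hR (basicTwo x) (basicTwo_mem x) (lcs_one_le x)
    (fun p => c₂ x p.1.1 p.1.2) ?_ (fun p g hg => c₂_eq_zero x hg _ _) ?_ hg
    fun p => h p.1.1 p.1.2 p.2
  · intro p g hg h hh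
    rw [c₂_mul, c₁_eq_zero x hg]; ring
  · rintro ⟨⟨i, j⟩, hij⟩ ⟨⟨k, l⟩, hkl⟩
    simp only [basicTwo, c₂_commutator, c₁_basis, Subtype.mk.injEq, Prod.mk.injEq]
    have hij : i < j := hij
    have hkl : k < l := hkl
    by_cases h1 : i = k <;> by_cases h2 : j = l <;> by_cases h3 : i = l <;> by_cases h4 : j = k <;>
      simp [h1, h2, h3, h4] <;> omega

theorem c₂_antisymm {g : F} (hg : g ∈ L 1) {i j : Fin m} (hij : i ≠ j) :
    c₂ x j i g = -c₂ x i j g := by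
  have h := c₂_shuffle x hij g
  rw [c₁_eq_zero x hg] at h
  linarith

/-- The coordinates of `γ_3 / γ_4` with respect to the basic commutators. -/
def coordThree (p : {p : Fin m × Fin m × Fin m // p.2.1 < p.1 ∧ p.2.1 ≤ p.2.2}) (g : F) : ℤ :=
  if p.1.2.1 = p.1.2.2 then c₃ x p.1.1 p.1.2.1 p.1.2.1 g
  else c₃ x p.1.1 p.1.2.1 p.1.2.2 g + c₃ x p.1.1 p.1.2.2 p.1.2.1 g

theorem coordThree_basicThree (p q) :
    coordThree x p (basicThree x q) = if p = q then 1 else 0 := by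
  obtain ⟨⟨i, j, k⟩, hji, hjk⟩ := p
  obtain ⟨⟨a, b, c⟩, hba, hbc⟩ := q
  simp only [coordThree, basicThree, c₃_commutator x _ _ _ (fun l => c₁_commutator x l _ _),
    c₂_commutator, c₁_basis, Subtype.mk.injEq, Prod.mk.injEq]
  replace hji : j < i := hji
  replace hjk : j ≤ k := hjk
  replace hba : b < a := hba
  replace hbc : b ≤ c := hbc
  grind

theorem mem_of_coordinates_three {R : Subgroup F} (hR : L 3 ≤ R) {g : F} (hg : g ∈ L 2)
    (h1 : ∀ i j : Fin m, j < i → ⁅⁅x i, x j⁆, x j⁆ ^ c₃ x i j j g ∈ R)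
    (h2 : ∀ i j k : Fin m, j < i → j < k →
      ⁅⁅x i, x j⁆, x k⁆ ^ (c₃ x i j k g + c₃ x i k j g) ∈ R) : g ∈ R := by
  refine mem_of_coordinates (Subgroup.lowerCentralSeries_antitone _ (by simp))
    (Subgroup.commutator_mono le_rfl le_top) hR (basicThree x) (basicThree_mem x) (lcs_two_le x)
    (coordThree x) ?_ ?_ (coordThree_basicThree x) hg ?_
  · intro p g hg h hh
    have hg1 : g ∈ L 1 := Subgroup.lowerCentralSeries_antitone _ (by simp) hg
    simp only [coordThree, c₃_mul, c₂_eq_zero x hg, c₁_eq_zero x hg1]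
    split_ifs <;> ring
  · intro p g hg
    simp only [coordThree, c₃_eq_zero x hg]
    simp
  · rintro ⟨⟨i, j, k⟩, hji, hjk⟩
    simp only [coordThree, basicThree]
    split_ifs with h
    · have h : j = k := h
      subst h
      exact h1 i j hji
    · exact h2 i j k hji (lt_of_le_of_ne hjk h)

end CoordinatesInGamma

section Expansion

variable {A : Type*} [Ring A]

theorem exists_one_add_pow_eq (X : A) (n : ℕ) :
    ∃ Q : A, (1 + X) ^ n - 1 = (n : ℤ) • X + (n.choose 2 : ℤ) • X ^ 2 + X ^ 3 * Q := by
  suffices h : ∃ Q : Polynomial ℤ, (1 + Polynomial.X) ^ n - 1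
      = (n : ℤ) • Polynomial.X + (n.choose 2 : ℤ) • Polynomial.X ^ 2 + Polynomial.X ^ 3 * Q by
    obtain ⟨Q, hQ⟩ := h
    refine ⟨Polynomial.aeval X Q, ?_⟩
    simpa only [map_sub, map_add, map_mul, map_pow, map_one, map_zsmul, Polynomial.aeval_X]
      using congrArg (Polynomial.aeval X) hQ
  induction n with
  | zero => exact ⟨0, by simp⟩
  | succ n ih =>
    obtain ⟨Q, hQ⟩ := ih
    refine ⟨Q * (1 + Polynomial.X) + (n.choose 2 : ℤ) • 1, ?_⟩
    rw [Nat.choose_succ_succ' n 1, Nat.choose_one_right]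
    simp only [zsmul_eq_mul] at hQ ⊢
    push_cast at hQ ⊢
    linear_combination (1 + Polynomial.X) * hQ

variable {I : Ideal A} [I.IsTwoSided]

theorem pow_mul_mem {X : A} (hX : X ∈ I) {n : ℕ} (hn : n ≠ 0) (Q : A) : X ^ n * Q ∈ I ^ n := by
  refine Ideal.mul_mem_right _ _ ?_
  induction n with
  | zero => exact absurd rfl hn
  | succ n ih =>
    rcases eq_or_ne n 0 with rfl | h
    · simpa [Submodule.pow_one] using hX
    · rw [pow_succ, Submodule.pow_succ]
      exact Ideal.mul_mem_mul (ih h) hX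

theorem one_add_pow_sub_mem_sq {X : A} (hX : X ∈ I) (n : ℕ) :
    (1 + X) ^ n - 1 - (n : ℤ) • X ∈ I ^ 2 := by
  obtain ⟨Q, hQ⟩ := exists_one_add_pow_eq X n
  have e : (1 + X) ^ n - 1 - (n : ℤ) • X = X ^ 2 * ((n.choose 2 : ℤ) • 1 + X * Q) := by
    rw [hQ, mul_add, ← mul_assoc, ← pow_succ, mul_smul_comm, mul_one]
    abel
  rw [e]
  exact pow_mul_mem hX two_ne_zero _

theorem one_add_pow_sub_mem_cube {X : A} (hX : X ∈ I) (n : ℕ) :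
    (1 + X) ^ n - 1 - (n : ℤ) • X - (n.choose 2 : ℤ) • X ^ 2 ∈ I ^ 3 := by
  obtain ⟨Q, hQ⟩ := exists_one_add_pow_eq X n
  have e : (1 + X) ^ n - 1 - (n : ℤ) • X - (n.choose 2 : ℤ) • X ^ 2 = X ^ 3 * Q := by
    rw [hQ]; abel
  rw [e]
  exact pow_mul_mem hX three_ne_zero _

variable {J : Ideal A}

/-- If `n = e t` and `(1 + Y) ^ e - 1 ∈ 𝔧`, then `((1 + X) ^ n - 1) Y ∈ 𝔦𝔧 + 𝔦 ^ 3`. -/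
theorem expansion_mem_cube {X Y : A} (hX : X ∈ I) (hY : Y ∈ I) {e n t : ℕ} (hn : n = e * t)
    (hV : (1 + Y) ^ e - 1 ∈ J) : ((1 + X) ^ n - 1) * Y ∈ I * J ⊔ I ^ 3 := by
  have h1 : ((1 + X) ^ n - 1 - (n : ℤ) • X) * Y ∈ I ^ 3 := by
    rw [Submodule.pow_succ]
    exact Ideal.mul_mem_mul (one_add_pow_sub_mem_sq hX n) hY
  have h2 : X * ((1 + Y) ^ e - 1 - (e : ℤ) • Y) ∈ I ^ 3 := by
    rw [Ideal.IsTwoSided.pow_succ]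
    exact Ideal.mul_mem_mul hX (one_add_pow_sub_mem_sq hY e)
  have h3 : X * ((1 + Y) ^ e - 1) ∈ I * J := Ideal.mul_mem_mul hX hV
  have key : ((1 + X) ^ n - 1) * Y = (t : ℤ) • (X * ((1 + Y) ^ e - 1))
      + (((1 + X) ^ n - 1 - (n : ℤ) • X) * Y
        - (t : ℤ) • (X * ((1 + Y) ^ e - 1 - (e : ℤ) • Y))) := by
    subst hn
    simp only [sub_mul, mul_sub, smul_mul_assoc, mul_smul_comm]
    push_cast
    module
  rw [key]
  exact Submodule.add_mem_sup (zsmul_mem h3 _) (sub_mem h1 (zsmul_mem h2 _))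

theorem expansion_mem_fourth {X Y : A} (hX : X ∈ I) (hY : Y ∈ I) {e n t r : ℕ} (hn : n = e * t)
    (hr : t * e.choose 2 = e * r) (hV : (1 + Y) ^ e - 1 ∈ J) :
    ((1 + X) ^ n - 1) * Y ∈ I * J ⊔ I ^ 4 := by
  obtain ⟨q, hq⟩ : ∃ q : ℤ, (n.choose 2 : ℤ) = e * q := by
    have h2 : ∀ k : ℕ, 2 * (k.choose 2 : ℤ) = k * (k - 1) := by
      intro k
      induction k with
      | zero => simp
      | succ k ih =>
        rw [Nat.choose_succ_succ' k 1, Nat.choose_one_right]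
        push_cast
        linear_combination ih
    refine ⟨r + e * t.choose 2, ?_⟩
    have hr' : (t : ℤ) * e.choose 2 = e * r := by exact_mod_cast hr
    have hn' : (n : ℤ) = e * t := by exact_mod_cast hn
    have h := h2 n
    rw [hn'] at h
    refine mul_left_cancel₀ (two_ne_zero (α := ℤ)) ?_
    linear_combination h + 2 * hr' - t * h2 e - (e : ℤ) ^ 2 * h2 t
  have h1 : ((1 + X) ^ n - 1 - (n : ℤ) • X - (n.choose 2 : ℤ) • X ^ 2) * Y ∈ I ^ 4 := by
    rw [Submodule.pow_succ]
    exact Ideal.mul_mem_mul (one_add_pow_sub_mem_cube hX n) hY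
  have h2 : X * ((1 + Y) ^ e - 1 - (e : ℤ) • Y - (e.choose 2 : ℤ) • Y ^ 2) ∈ I ^ 4 := by
    rw [Ideal.IsTwoSided.pow_succ]
    exact Ideal.mul_mem_mul hX (one_add_pow_sub_mem_cube hY e)
  have hsq : ∀ P ∈ I ^ 2, P * ((1 + Y) ^ e - 1 - (e : ℤ) • Y) ∈ I ^ 4 := by
    intro P hP
    rw [show 4 = 2 + 2 from rfl, Ideal.IsTwoSided.pow_add]
    exact Ideal.mul_mem_mul hP (one_add_pow_sub_mem_sq hY e)
  have hX2 : X ^ 2 ∈ I ^ 2 := by simpa using pow_mul_mem hX two_ne_zero 1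
  have hXY : X * Y ∈ I ^ 2 := by
    rw [Submodule.pow_succ, Submodule.pow_one]
    exact Ideal.mul_mem_mul hX hY
  have h3 : ((t : ℤ) • X - (r : ℤ) • (X * Y) + q • X ^ 2) * ((1 + Y) ^ e - 1) ∈ I * J :=
    Ideal.mul_mem_mul (add_mem (sub_mem (zsmul_mem hX _)
      (zsmul_mem (Ideal.mul_mem_right _ _ hX) _))
      (zsmul_mem (Ideal.pow_le_self two_ne_zero hX2) _)) hV
  have key : ((1 + X) ^ n - 1) * Y
      = ((t : ℤ) • X - (r : ℤ) • (X * Y) + q • X ^ 2) * ((1 + Y) ^ e - 1)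
        + (((1 + X) ^ n - 1 - (n : ℤ) • X - (n.choose 2 : ℤ) • X ^ 2) * Y
          - (t : ℤ) • (X * ((1 + Y) ^ e - 1 - (e : ℤ) • Y - (e.choose 2 : ℤ) • Y ^ 2))
          + (r : ℤ) • (X * Y * ((1 + Y) ^ e - 1 - (e : ℤ) • Y))
          - q • (X ^ 2 * ((1 + Y) ^ e - 1 - (e : ℤ) • Y))) := by
    have hr' : (t : ℤ) * e.choose 2 = e * r := by exact_mod_cast hr
    have hn' : (n : ℤ) = e * t := by exact_mod_cast hn
    rw [hq, hn']
    generalize (1 + X) ^ n - 1 = U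
    generalize (1 + Y) ^ e - 1 = V
    simp only [sub_mul, mul_sub, add_mul, smul_mul_assoc, mul_smul_comm, pow_two Y, mul_assoc]
    have h0 : ((e : ℤ) * r - t * e.choose 2) • (X * (Y * Y)) = 0 := by
      rw [hr', sub_self, zero_smul]
    rw [← sub_eq_zero, ← h0]
    module
  rw [key]
  exact Submodule.add_mem_sup h3 (sub_mem (add_mem (sub_mem h1 (zsmul_mem h2 _))
    (zsmul_mem (hsq _ hXY) _)) (zsmul_mem (hsq _ hX2) _))

end Expansion

section Sufficient

theorem of_commutator_sub_one_mem {J : Ideal (MonoidAlgebra ℤ F)} [J.IsTwoSided] {g h : F}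
    (h1 : (MonoidAlgebra.of ℤ F g - 1) * (MonoidAlgebra.of ℤ F h - 1) ∈ J)
    (h2 : (MonoidAlgebra.of ℤ F h - 1) * (MonoidAlgebra.of ℤ F g - 1) ∈ J) :
    MonoidAlgebra.of ℤ F ⁅g, h⁆ - 1 ∈ J := by
  have e : MonoidAlgebra.of ℤ F ⁅g, h⁆ - 1
      = ((MonoidAlgebra.of ℤ F g - 1) * (MonoidAlgebra.of ℤ F h - 1)
        - (MonoidAlgebra.of ℤ F h - 1) * (MonoidAlgebra.of ℤ F g - 1))
          * MonoidAlgebra.of ℤ F (g⁻¹ * h⁻¹) := by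
    have e1 : (MonoidAlgebra.of ℤ F g - 1) * (MonoidAlgebra.of ℤ F h - 1)
        - (MonoidAlgebra.of ℤ F h - 1) * (MonoidAlgebra.of ℤ F g - 1)
        = MonoidAlgebra.of ℤ F (g * h) - MonoidAlgebra.of ℤ F (h * g) := by
      rw [map_mul, map_mul]
      noncomm_ring
    rw [e1, sub_mul, ← map_mul, ← map_mul, ← map_one (MonoidAlgebra.of ℤ F)]
    congr 2
    · simp [commutatorElement_def, mul_assoc]
    · group
  rw [e]
  exact Ideal.mul_mem_right _ _ (sub_mem h1 h2)

theorem of_sub_one_mem_pow {n : ℕ} {g : F} (hg : g ∈ L n) :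
    MonoidAlgebra.of ℤ F g - 1 ∈ augIdeal F ^ (n + 1) := by
  suffices h : L n ≤ D (n + 1) (⊥ : Ideal (MonoidAlgebra ℤ F)) by
    have h2 : MonoidAlgebra.of ℤ F g - 1 ∈ ⊥ ⊔ augIdeal F ^ (n + 1) := h hg
    rwa [bot_sup_eq] at h2
  clear hg
  induction n with
  | zero =>
    intro g _
    refine Submodule.mem_sup_right ?_
    rw [zero_add, Submodule.pow_one]
    exact of_sub_one_mem g
  | succ n ih =>
    rw [Subgroup.lowerCentralSeries_succ, Subgroup.commutator_le]
    intro p hp v _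
    refine Submodule.mem_sup_right ?_
    have hp' : MonoidAlgebra.of ℤ F p - 1 ∈ ⊥ ⊔ augIdeal F ^ (n + 1) := ih hp
    rw [bot_sup_eq] at hp'
    refine of_commutator_sub_one_mem ?_ ?_
    · rw [Submodule.pow_succ]
      exact Ideal.mul_mem_mul hp' (of_sub_one_mem v)
    · rw [Ideal.IsTwoSided.pow_succ]
      exact Ideal.mul_mem_mul (of_sub_one_mem v) hp'

theorem lcs_le_D (n : ℕ) (I : Ideal (MonoidAlgebra ℤ F)) : L n ≤ D (n + 1) I :=
  fun _ hg => Submodule.mem_sup_right (of_sub_one_mem_pow hg)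

instance twoSided_sup {A : Type*} [Ring A] (I J : Ideal A) [I.IsTwoSided] [J.IsTwoSided] :
    (I ⊔ J).IsTwoSided := by
  refine ⟨fun {a} b ha => ?_⟩
  obtain ⟨u, hu, v, hv, rfl⟩ := Submodule.mem_sup.1 ha
  rw [add_mul]
  exact Submodule.add_mem_sup (Ideal.mul_mem_right _ _ hu) (Ideal.mul_mem_right _ _ hv)

theorem of_sub_one_mem_relIdeal {H : Subgroup F} {h : F} (hh : h ∈ H) :
    MonoidAlgebra.of ℤ F h - 1 ∈ relIdeal H := Ideal.subset_span ⟨h, hh, rfl⟩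

theorem gamma_two_le_D (H : Subgroup F) [H.Normal] (n : ℕ) :
    gamma H 2 ≤ D n (augIdeal F * relIdeal H) := by
  have := relIdeal_isTwoSided H
  change ⁅H, H⁆ ≤ _
  rw [Subgroup.commutator_le]
  intro s hs t ht
  exact of_commutator_sub_one_mem
    (Submodule.mem_sup_left (Ideal.mul_mem_mul (of_sub_one_mem s) (of_sub_one_mem_relIdeal ht)))
    (Submodule.mem_sup_left (Ideal.mul_mem_mul (of_sub_one_mem t) (of_sub_one_mem_relIdeal hs)))

theorem exists_commutator_pow_eq {N : Subgroup F} {u y : F} (h : ∀ a : ℕ, ⁅u, ⁅u ^ a, y⁆⁆ ∈ N)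
    (n : ℕ) : ∃ z ∈ N, ⁅u ^ n, y⁆ = z * ⁅u, y⁆ ^ n := by
  induction n with
  | zero => exact ⟨1, one_mem _, by simp⟩
  | succ n ih =>
    obtain ⟨z, hz, e⟩ := ih
    refine ⟨⁅u, ⁅u ^ n, y⁆⁆ * z, mul_mem (h n) hz, ?_⟩
    rw [pow_succ' u, commutatorElement_mul_left_eq_conj_mul, conj_eq_commutator_mul, pow_succ]
    nth_rewrite 2 [e]
    simp only [mul_assoc]

variable {m : ℕ} (x : FreeGroupBasis (Fin m) F) (e : Fin m → ℕ)

theorem lcs_one_le_S : L 1 ≤ S x e := le_sup_right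

instance S_normal : (S x e).Normal := Subgroup.Normal.of_commutator_le _ (lcs_one_le_S x e)

theorem pow_mem_S (i : Fin m) : x i ^ e i ∈ S x e :=
  Subgroup.mem_sup_left (Subgroup.subset_closure ⟨i, rfl⟩)

theorem one_add_pow_sub_one (g : F) (n : ℕ) :
    (1 + (MonoidAlgebra.of ℤ F g - 1)) ^ n - 1 = MonoidAlgebra.of ℤ F (g ^ n) - 1 := by
  rw [add_sub_cancel, map_pow]

theorem commutator_pow_mem_D_three {i j : Fin m} (hij : e j ∣ e i) :
    ⁅x i ^ e i, x j⁆ ∈ D 3 (augIdeal F * relIdeal (S x e)) := by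
  have := relIdeal_isTwoSided (S x e)
  obtain ⟨t, ht⟩ := hij
  refine of_commutator_sub_one_mem ?_ (Submodule.mem_sup_left (Ideal.mul_mem_mul
    (of_sub_one_mem _) (of_sub_one_mem_relIdeal (pow_mem_S x e i))))
  rw [← one_add_pow_sub_one]
  refine expansion_mem_cube (of_sub_one_mem _) (of_sub_one_mem _) ht ?_
  rw [one_add_pow_sub_one]
  exact of_sub_one_mem_relIdeal (pow_mem_S x e j)

theorem commutator_pow_zpow_mem_D_four {i j : Fin m} (hij : e j ∣ e i) {a : ℤ}
    (ha : (e j : ℤ) ∣ ((e i / e j * (e j).choose 2 : ℕ) : ℤ) * a) :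
    ⁅x i ^ e i, x j⁆ ^ a ∈ D 4 (augIdeal F * relIdeal (S x e)) := by
  have key : ∀ b : ℕ, e j ∣ e i / e j * (e j).choose 2 * b →
      ⁅x i ^ e i, x j⁆ ^ b ∈ D 4 (augIdeal F * relIdeal (S x e)) := by
    intro b hb
    have := relIdeal_isTwoSided (S x e)
    obtain ⟨z, hz, hzb⟩ := exists_commutator_pow_eq (N := gamma (S x e) 2) (u := x i ^ e i)
      (y := x j) (fun a => Subgroup.commutator_mem_commutator (pow_mem_S x e i)
        (lcs_one_le_S x e (Subgroup.commutator_mem_commutator (Subgroup.mem_top _)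
          (Subgroup.mem_top _)))) b
    rw [eq_inv_mul_of_mul_eq hzb.symm]
    refine mul_mem (inv_mem (gamma_two_le_D _ _ hz)) ?_
    refine of_commutator_sub_one_mem ?_ (Submodule.mem_sup_left (Ideal.mul_mem_mul
      (of_sub_one_mem _) (of_sub_one_mem_relIdeal (pow_mem (pow_mem_S x e i) b))))
    obtain ⟨r, hr⟩ := hb
    rw [← pow_mul, ← one_add_pow_sub_one]
    refine expansion_mem_fourth (e := e j) (of_sub_one_mem _) (of_sub_one_mem _) (t := e i / e j * b) (r := r)
      ?_ ?_ ?_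
    · rw [← mul_assoc, Nat.mul_div_cancel' hij]
    · rw [← hr]; ring
    · rw [one_add_pow_sub_one]
      exact of_sub_one_mem_relIdeal (pow_mem_S x e j)
  obtain ⟨b, rfl | rfl⟩ := Int.eq_nat_or_neg a
  · rw [zpow_natCast]
    exact key b (by exact_mod_cast ha)
  · rw [zpow_neg, zpow_natCast]
    rw [mul_neg, dvd_neg] at ha
    exact inv_mem (key b (by exact_mod_cast ha))

end Sufficient

section Main

variable {m : ℕ} (x : FreeGroupBasis (Fin m) F) (e : Fin m → ℕ)

theorem exists_c₂_eq (he : ∀ i j : Fin m, i ≤ j → e j ∣ e i) {w : F}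
    (hw : w ∈ D 3 (augIdeal F * relIdeal (S x e))) {i j : Fin m} (hij : i < j) :
    ∃ d : ℤ, c₂ x i j w = e i * d := by
  have hw1 : w ∈ L 1 := mem_lcs_one_of_c₁_eq_zero x
    (c₁_eq_zero_of_mem_D x e (D_mono (by simp) _ hw))
  have h := dvd_c₂_of_mem_D x e he hw j i
  rwa [c₂_antisymm x hw1 hij.ne, dvd_neg] at h

theorem exists_commutator_pow_eq_mul (i j : Fin m) (n : ℕ) :
    ∃ z ∈ L 2, ⁅x i ^ n, x j⁆ = z * ⁅x i, x j⁆ ^ n :=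
  exists_commutator_pow_eq (fun _ => commutator_mem_lcs_succ'
    (commutator_mem_lcs_succ (n := 0) (Subgroup.mem_top _) _) _) n

theorem zpow_commutator_mem {p : F} (hp : p ∈ L 1) (k : Fin m) (d : ℤ) :
    ⁅p, x k⁆ ^ ((e k : ℤ) * d) ∈ gamma (S x e) 2 ⊔ L 3 := by
  obtain ⟨z, hz, h⟩ := exists_commutator_pow_eq (N := L 3) (u := x k) (y := p)
    (fun _ => commutator_mem_lcs_succ' (commutator_mem_lcs_succ' hp _) _) (e k)
  rw [zpow_mul, ← commutatorElement_inv (x k) p, zpow_natCast, inv_pow, eq_inv_mul_of_mul_eq h.symm]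
  exact zpow_mem (inv_mem (mul_mem (inv_mem (Subgroup.mem_sup_right hz)) (Subgroup.mem_sup_left
    (Subgroup.commutator_mem_commutator (pow_mem_S x e k) (lcs_one_le_S x e hp))))) d

theorem mem_of_mem_D_of_mem_lcs_two (he : ∀ i j : Fin m, i ≤ j → e j ∣ e i) {g : F}
    (hg : g ∈ L 2) (hgD : g ∈ D 4 (augIdeal F * relIdeal (S x e))) :
    g ∈ gamma (S x e) 2 ⊔ L 3 := by
  have hc : ∀ i j : Fin m, ⁅x i, x j⁆ ∈ L 1 := fun i j =>
    commutator_mem_lcs_succ (n := 0) (Subgroup.mem_top _) _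
  refine mem_of_coordinates_three x le_sup_right hg (fun i j hji => ?_) fun i j k hji hjk => ?_
  · have h := dvd_c₃_self_of_mem_D x e he hgD i j
    rw [c₂_eq_zero x hg, mul_zero, sub_zero] at h
    obtain ⟨d, hd⟩ := (mul_dvd_mul_iff_left two_ne_zero).1 h
    rw [hd]
    exact zpow_commutator_mem x e (hc i j) j d
  · obtain ⟨d, hd⟩ := dvd_c₃_of_mem_D x e he hgD i hjk
    rw [hd]
    exact zpow_commutator_mem x e (hc i j) k d

theorem dvd_of_c₂_eq (he : ∀ i j : Fin m, i ≤ j → e j ∣ e i) {w : F}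
    (hw : w ∈ D 4 (augIdeal F * relIdeal (S x e))) {i j : Fin m} (hij : i < j) {d : ℤ}
    (hd : c₂ x i j w = e i * d) : (e j : ℤ) ∣ ((e i / e j * (e j).choose 2 : ℕ) : ℤ) * d := by
  have hw1 : w ∈ L 1 := mem_lcs_one_of_c₁_eq_zero x
    (c₁_eq_zero_of_mem_D x e (D_mono (by simp) _ hw))
  have h1 := dvd_c₃_self_of_mem_D x e he hw i j
  have h2 := mul_dvd_mul_left 2 (dvd_c₃_of_mem_D x e he hw j hij)
  have h3 := c₃_shuffle x hij.ne w
  rw [c₁_eq_zero x hw1, zero_mul] at h3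
  have h4 : 2 * (e j : ℤ) ∣ (e j - 1) * (e i * d) := by
    rw [← hd]
    refine (dvd_neg.2 (dvd_add h1 h2)).trans (dvd_of_eq ?_)
    linear_combination -2 * h3
  obtain ⟨q, hq⟩ := he i j hij.le
  rcases Nat.eq_zero_or_pos (e j) with h0 | hpos
  · simp [h0]
  · rw [hq, Nat.mul_div_cancel_left _ hpos]
    have h5 : 2 * ((e j).choose 2 : ℤ) = e j * (e j - 1) := by
      have h6 := Nat.choose_two_right (e j)
      have h7 : 2 * (e j).choose 2 = e j * (e j - 1) := by
        rw [h6, Nat.mul_div_cancel' (Nat.even_mul_pred_self _).two_dvd]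
      have h8 := congrArg (Nat.cast : ℕ → ℤ) h7
      push_cast [Nat.cast_sub hpos] at h8
      exact h8
    refine (mul_dvd_mul_iff_left (two_ne_zero (α := ℤ))).1 (h4.trans (dvd_of_eq ?_))
    rw [hq]
    push_cast
    linear_combination -(q * d) * h5

end Main

end GenDim

end

theorem mainTheorem12 {F : Type*} [Group F] {m : ℕ} (x : FreeGroupBasis (Fin m) F)
    (e : Fin m → ℕ) (he : ∀ i j : Fin m, i ≤ j → e j ∣ e i) :
    GenDim.D 3 (GenDim.augIdeal F * GenDim.relIdeal (GenDim.S x e)) =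
        Subgroup.closure {w : F | ∃ i j : Fin m, i < j ∧ w = ⁅x i ^ e i, x j⁆} ⊔
          (GenDim.gamma (GenDim.S x e) 2 ⊔ GenDim.gamma (⊤ : Subgroup F) 3) ∧
    GenDim.D 4 (GenDim.augIdeal F * GenDim.relIdeal (GenDim.S x e)) =
        Subgroup.closure {w : F | ∃ (i j : Fin m) (a : ℤ), i < j ∧
            (e j : ℤ) ∣ ((e i / e j * (e j).choose 2 : ℕ) : ℤ) * a ∧
            w = ⁅x i ^ e i, x j⁆ ^ a} ⊔
          (GenDim.gamma (GenDim.S x e) 2 ⊔ GenDim.gamma (⊤ : Subgroup F) 4) := by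
  have hmem1 : ∀ {n : ℕ} {w : F}, w ∈ GenDim.D (n + 2) (GenDim.augIdeal F *
      GenDim.relIdeal (GenDim.S x e)) → w ∈ (⊤ : Subgroup F).lowerCentralSeries 1 := fun hw =>
    GenDim.mem_lcs_one_of_c₁_eq_zero x
      (GenDim.c₁_eq_zero_of_mem_D x e (GenDim.D_mono (by simp) _ hw))
  constructor
  · refine le_antisymm (fun w hw => ?_) (sup_le ((Subgroup.closure_le _).2 ?_)
      (sup_le (GenDim.gamma_two_le_D _ _) (GenDim.lcs_le_D 2 _)))
    · have hR := (le_sup_right : GenDim.gamma (⊤ : Subgroup F) 3 ≤ GenDim.gamma (GenDim.S x e) 2 ⊔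
        GenDim.gamma (⊤ : Subgroup F) 3).trans (le_sup_right (a := Subgroup.closure
          {w : F | ∃ i j : Fin m, i < j ∧ w = ⁅x i ^ e i, x j⁆}))
      refine GenDim.mem_of_coordinates_two x hR (hmem1 (n := 1) hw) fun i j hij => ?_
      obtain ⟨d, hd⟩ := GenDim.exists_c₂_eq x e he hw hij
      obtain ⟨z, hz, h⟩ := GenDim.exists_commutator_pow_eq_mul x i j (e i)
      rw [hd, zpow_mul, zpow_natCast, eq_inv_mul_of_mul_eq h.symm]
      exact zpow_mem (mul_mem (inv_mem (hR hz)) (Subgroup.mem_sup_left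
        (Subgroup.subset_closure ⟨i, j, hij, rfl⟩))) d
    · rintro _ ⟨i, j, hij, rfl⟩
      exact GenDim.commutator_pow_mem_D_three x e (he i j hij.le)
  · have hle : Subgroup.closure {w : F | ∃ (i j : Fin m) (a : ℤ), i < j ∧
            (e j : ℤ) ∣ ((e i / e j * (e j).choose 2 : ℕ) : ℤ) * a ∧
            w = ⁅x i ^ e i, x j⁆ ^ a} ⊔
          (GenDim.gamma (GenDim.S x e) 2 ⊔ GenDim.gamma (⊤ : Subgroup F) 4) ≤
        GenDim.D 4 (GenDim.augIdeal F * GenDim.relIdeal (GenDim.S x e)) := by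
      refine sup_le ((Subgroup.closure_le _).2 ?_)
        (sup_le (GenDim.gamma_two_le_D _ _) (GenDim.lcs_le_D 3 _))
      rintro _ ⟨i, j, a, hij, ha, rfl⟩
      exact GenDim.commutator_pow_zpow_mem_D_four x e (he i j hij.le) ha
    refine le_antisymm (fun w hw => ?_) hle
    have h2 := GenDim.mem_of_coordinates_two x (le_sup_right (a := Subgroup.closure
      {w : F | ∃ (i j : Fin m) (a : ℤ), i < j ∧
            (e j : ℤ) ∣ ((e i / e j * (e j).choose 2 : ℕ) : ℤ) * a ∧
            w = ⁅x i ^ e i, x j⁆ ^ a} ⊔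
          (GenDim.gamma (GenDim.S x e) 2 ⊔ GenDim.gamma (⊤ : Subgroup F) 4)))
      (hmem1 (n := 2) hw) fun i j hij => ?_
    · obtain ⟨r, hr, g, hg, rfl⟩ := Subgroup.mem_sup_of_normal_right.1 h2
      exact mul_mem hr (Subgroup.mem_sup_right (GenDim.mem_of_mem_D_of_mem_lcs_two x e he hg
        ((Subgroup.mul_mem_cancel_left _ (hle hr)).1 hw)))
    · obtain ⟨d, hd⟩ := GenDim.exists_c₂_eq x e he (GenDim.D_mono (by simp) _ hw) hij
      obtain ⟨z, hz, h⟩ := GenDim.exists_commutator_pow_eq_mul x i j (e i)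
      have hq : (QuotientGroup.mk (⁅x i ^ e i, x j⁆ ^ d) : F ⧸ (⊤ : Subgroup F).lowerCentralSeries 2)
          = QuotientGroup.mk (⁅x i, x j⁆ ^ GenDim.c₂ x i j w) := by
        rw [hd, zpow_mul, zpow_natCast, QuotientGroup.mk_zpow, QuotientGroup.mk_zpow, h,
          QuotientGroup.mk_mul, (QuotientGroup.eq_one_iff z).2 hz, one_mul]
      have hpow : ⁅x i ^ e i, x j⁆ ^ d ∈ Subgroup.closure {w : F | ∃ (i j : Fin m) (a : ℤ), i < j ∧
            (e j : ℤ) ∣ ((e i / e j * (e j).choose 2 : ℕ) : ℤ) * a ∧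
            w = ⁅x i ^ e i, x j⁆ ^ a} :=
        Subgroup.subset_closure ⟨i, j, d, hij, GenDim.dvd_of_c₂_eq x e he hw hij hd, rfl⟩
      rw [← mul_inv_cancel_left (⁅x i ^ e i, x j⁆ ^ d) (⁅x i, x j⁆ ^ GenDim.c₂ x i j w)]
      exact mul_mem (Subgroup.mem_sup_left (Subgroup.mem_sup_left hpow))
        (Subgroup.mem_sup_right (QuotientGroup.eq.1 hq))
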